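/- Let $\bar A\in\{0,*\}^{n\times n}$, $\bar C\in\{0,*\}^{p\times n}$, $\bar C'\in\{0,*\}^{p'\times n}$ and $\bar F\in\{0,*\}^{r\times n}$ be structured matrices: each entry is either a fixed zero or a free real parameter $*$, all parameters being independent, and a realization is obtained by giving real values to the parameters. A real triple $(A,C,F)$ is functionally observable if for the system $\dot x=Ax+Bu$, $y=Cx$ (with any input matrix $B$) and for every initial state $x(0)$ and every input $u$ there is a finite time $T$ such that $Fx(0)$ is uniquely determined by $y(t)$ and $u(t)$, $0\le t\le T$. The triple $(\bar A,\bar C,\bar F)$ is structurally functionally observable (SFO) if there is a proper algebraic variety $\mathbb V$ (the real solution set of a system of polynomial equations, not the whole space) in the space of all parameters of $(\bar A,\bar C,\bar F)$ such that every realization outside $\mathbb V$ is functionally observable. Let $X_F$ be the set of state vertices $x_i$ for which the $i$-th column of $\bar F$ is nonzero (the functional states), and let $E_{C}=\{(x_i,y_j):\bar C_{ji}\neq 0\}$ and $E_{C'}=\{(x_i,y_j):\bar C'_{ji}\neq 0\}$ be the sets of sensor edges. Proposition. If $(\bar A,\bar C,\bar F)$ is SFO, $E_C\subseteq E_{C'}$,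 and every edge in $E_{C'}\setminus E_C$ has its initial vertex in $X_F$, then $(\bar A,\bar C',\bar F)$ is SFO. -/

import Mathlib

namespace StructuredSystem

/-- A `p × n` structured matrix: the entry `true` stands for a free parameter `*`, the entry
`false` for a fixed zero. -/
abbrev Pattern (p n : ℕ) : Type := Matrix (Fin p) (Fin n) Bool

/-- The positions of the free parameters of a structured matrix. -/
abbrev Pattern.Stars {p n : ℕ} (M : Pattern p n) : Type :=
  {e : Fin p × Fin n // M e.1 e.2 = true}

/-- The realization of a structured matrix given by the values `θ` of its free parameters. -/
def Pattern.realization {p n : ℕ} (M : Pattern p n) (θ : M.Stars → ℝ) :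
    Matrix (Fin p) (Fin n) ℝ :=
  fun i j => if h : M i j = true then θ ⟨(i, j), h⟩ else 0

/-- The state vertices that correspond to the nonzero columns of a structured matrix with one
column for each state. For `F` these are the functional states. -/
def Pattern.columnStates {p n : ℕ} (M : Pattern p n) : Set (Fin n) :=
  {i | ∃ k : Fin p, M k i = true}

/-- The edge set `E_C`: the edges `(x_i, y_j)` with `C j i ≠ 0`. The output vertices `y_j` are
labelled by natural numbers, so that edge sets of output matrices with different numbers of
rows can be compared. -/
def Pattern.sensorEdges {p n : ℕ} (C : Pattern p n) : Set (Fin n × ℕ) :=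
  {e | ∃ j : Fin p, e.2 = (j : ℕ) ∧ C j e.1 = true}

/-- The set of initial vertices of a set of sensor edges. -/
def initialVertices {n : ℕ} (E : Set (Fin n × ℕ)) : Set (Fin n) :=
  Prod.fst '' E

/-- `x` is a state trajectory, for times `t ≥ 0`, of `x'(t) = A x(t) + B u(t)`. -/
def IsTrajectory {n m : ℕ} (A : Matrix (Fin n) (Fin n) ℝ) (B : Matrix (Fin n) (Fin m) ℝ)
    (u : ℝ → Fin m → ℝ) (x : ℝ → Fin n → ℝ) : Prop :=
  ∀ t : ℝ, 0 ≤ t →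
    HasDerivWithinAt x (A.mulVec (x t) + B.mulVec (u t)) (Set.Ici 0) t

/-- Functional observability of `(A, C, F)`: whatever the input matrix `B`, for every initial
state and input (hence every trajectory `x` with its input `u`) there is a finite time `T` such
that `F x(0)` is uniquely determined by the output `y = C x` and the input on `[0, T]`. -/
def FunctionallyObservable {n p r : ℕ} (A : Matrix (Fin n) (Fin n) ℝ)
    (C : Matrix (Fin p) (Fin n) ℝ) (F : Matrix (Fin r) (Fin n) ℝ) : Prop :=
  ∀ (m : ℕ) (B : Matrix (Fin n) (Fin m) ℝ) (u : ℝ → Fin m → ℝ) (x : ℝ → Fin n → ℝ),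
    IsTrajectory A B u x →
      ∃ T : ℝ, 0 < T ∧
        ∀ (u' : ℝ → Fin m → ℝ) (x' : ℝ → Fin n → ℝ), IsTrajectory A B u' x' →
          (∀ t ∈ Set.Icc 0 T, u' t = u t ∧ C.mulVec (x' t) = C.mulVec (x t)) →
            F.mulVec (x' 0) = F.mulVec (x 0)

/-- A proper variety in `ℝ^σ`: the set of real solutions of a system of polynomial equations
that is not the entire space. -/
def IsProperVariety {σ : Type} (V : Set (σ → ℝ)) : Prop :=
  (∃ S : Set (MvPolynomial σ ℝ), V = {θ | ∀ f ∈ S, MvPolynomial.eval θ f = 0}) ∧ V ≠ Set.univ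

/-- Structural functional observability: outside a proper variety of the joint parameter space
of the three structured matrices, every realization is functionally observable. -/
def StructurallyFunctionallyObservable {n p r : ℕ} (A : Pattern n n) (C : Pattern p n)
    (F : Pattern r n) : Prop :=
  ∃ V : Set (A.Stars ⊕ C.Stars ⊕ F.Stars → ℝ), IsProperVariety V ∧
    ∀ θ : A.Stars ⊕ C.Stars ⊕ F.Stars → ℝ, θ ∉ V →
      FunctionallyObservable
        (A.realization fun e => θ (Sum.inl e))
        (C.realization fun e => θ (Sum.inr (Sum.inl e)))
        (F.realization fun e => θ (Sum.inr (Sum.inr e)))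

end StructuredSystem

open Matrix

namespace StructuredSystem

/-! Write N(A, C) for the unobservable subspace; functional observability means that F vanishes on
N(A, C). Fix generic A and C', and let C be the restriction of C' to the old sensor edges. Varying F
in the SFO hypothesis shows that every v in N(A, C) vanishes on all functional states, and so does
every `A ^ k v` by invariance. New sensors read only functional states, so N(A, C) ≤ N(A, C'). The
reverse inclusion is not automatic, since new entries may share a row with old ones. It follows by
dimension: the generic dimension of N(A, C') is at most its value with the new parameters set to
zero, hence at most the minimal dimension of N(A, C)
(`exists_polynomial_finrank_unobservableSubspace_le`). So the two spaces agree and F vanishes on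
N(A, C'). -/

/-! ### Functional observability and the unobservable subspace -/

/-- The unobservable subspace of `(A, C)`: the states `v` with `C A ^ k v = 0` for all `k`. -/
def unobservableSubspace {n p : ℕ} (A : Matrix (Fin n) (Fin n) ℝ)
    (C : Matrix (Fin p) (Fin n) ℝ) : Submodule ℝ (Fin n → ℝ) :=
  ⨅ k : ℕ, LinearMap.ker (C * A ^ k).mulVecLin

theorem mem_unobservableSubspace {n p : ℕ} {A : Matrix (Fin n) (Fin n) ℝ}
    {C : Matrix (Fin p) (Fin n) ℝ} {v : Fin n → ℝ} :
    v ∈ unobservableSubspace A C ↔ ∀ k : ℕ, C *ᵥ (A ^ k *ᵥ v) = 0 := by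
  simp [unobservableSubspace, Submodule.mem_iInf, mulVec_mulVec]

theorem pow_mulVec_mem_unobservableSubspace {n p : ℕ} {A : Matrix (Fin n) (Fin n) ℝ}
    {C : Matrix (Fin p) (Fin n) ℝ} {v : Fin n → ℝ} (hv : v ∈ unobservableSubspace A C) (l : ℕ) :
    A ^ l *ᵥ v ∈ unobservableSubspace A C := by
  rw [mem_unobservableSubspace] at hv ⊢
  intro k
  rw [mulVec_mulVec v, ← pow_add]
  exact hv _

/-- The flow of a linear system exists from every initial state, and if the output vanishes to
all orders at time zero, then it vanishes at all times. -/
theorem exists_trajectory_output_eq_zero {n p : ℕ} (A : Matrix (Fin n) (Fin n) ℝ)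
    (C : Matrix (Fin p) (Fin n) ℝ) {v : Fin n → ℝ} (hv : v ∈ unobservableSubspace A C) :
    ∃ x : ℝ → Fin n → ℝ, x 0 = v ∧ (∀ t, HasDerivAt x (A *ᵥ x t) t) ∧ ∀ t, C *ᵥ x t = 0 := by
  rw [mem_unobservableSubspace] at hv
  let L : (Fin n → ℝ) →L[ℝ] (Fin n → ℝ) := LinearMap.toContinuousLinearMap A.mulVecLin
  have hLpow : ∀ (k : ℕ) (w : Fin n → ℝ), (L ^ k) w = A ^ k *ᵥ w := by
    intro k
    induction k with
    | zero => intro w; simp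
    | succ k ih =>
      intro w
      rw [pow_succ, pow_succ, ← mulVec_mulVec, ← ih]
      rfl
  refine ⟨fun t => NormedSpace.exp (t • L) v, by simp, fun t => ?_, fun t => ?_⟩
  · have h := (hasDerivAt_exp_smul_const' (𝕂 := ℝ) L t).clm_apply (hasDerivAt_const t v)
    simpa [L] using h
  · have h := NormedSpace.exp_series_hasSum_exp' (𝕂 := ℝ) (t • L)
    have h1 := (h.mapL (ContinuousLinearMap.apply ℝ (Fin n → ℝ) v)).mapL
      (LinearMap.toContinuousLinearMap C.mulVecLin)
    have h2 : ∀ k : ℕ, (LinearMap.toContinuousLinearMap C.mulVecLin)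
        ((ContinuousLinearMap.apply ℝ (Fin n → ℝ) v)
          (((k.factorial : ℝ)⁻¹) • (t • L) ^ k)) = 0 := by
      intro k
      simp [smul_pow, hLpow, hv]
    simp only [h2] at h1
    exact h1.unique hasSum_zero

theorem FunctionallyObservable.mulVec_eq_zero {n p r : ℕ} {A : Matrix (Fin n) (Fin n) ℝ}
    {C : Matrix (Fin p) (Fin n) ℝ} {F : Matrix (Fin r) (Fin n) ℝ}
    (h : FunctionallyObservable A C F) {v : Fin n → ℝ} (hv : v ∈ unobservableSubspace A C) :
    F *ᵥ v = 0 := by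
  obtain ⟨x, hx0, hx, hCx⟩ := exists_trajectory_output_eq_zero A C hv
  -- The reference is the zero trajectory of the system without inputs.
  obtain ⟨T, -, hT⟩ := h 0 0 0 0 (fun t _ => by
    simpa using! hasDerivWithinAt_const t (Set.Ici 0) (0 : Fin n → ℝ))
  have := hT 0 x (fun t _ => by simpa using (hx t).hasDerivWithinAt) (fun t _ => by simp [hCx])
  simpa [hx0] using this

/-- The difference of two trajectories with equal input and output solves the homogeneous equation;
differentiating its zero output repeatedly puts its initial value in the unobservable subspace. Any
`T > 0` would do. -/
theorem functionallyObservable_of_mulVec_eq_zero {n p r : ℕ} {A : Matrix (Fin n) (Fin n) ℝ}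
    {C : Matrix (Fin p) (Fin n) ℝ} {F : Matrix (Fin r) (Fin n) ℝ}
    (h : ∀ v ∈ unobservableSubspace A C, F *ᵥ v = 0) : FunctionallyObservable A C F := by
  intro m B u x hx
  refine ⟨1, one_pos, fun u' x' hx' heq => ?_⟩
  let z : ℝ → Fin n → ℝ := fun t => x' t - x t
  have hz : ∀ t ∈ Set.Icc (0 : ℝ) 1, HasDerivWithinAt z (A *ᵥ z t) (Set.Icc 0 1) t := by
    intro t ht
    have h1 := ((hx' t ht.1).sub (hx t ht.1)).mono
      (fun s (hs : s ∈ Set.Icc (0 : ℝ) 1) => hs.1)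
    have h2 : A *ᵥ x' t + B *ᵥ u' t - (A *ᵥ x t + B *ᵥ u t) = A *ᵥ z t := by
      rw [(heq t ht).1, mulVec_sub]; abel
    rw [h2] at h1
    exact h1
  have hC : ∀ k : ℕ, ∀ t ∈ Set.Icc (0 : ℝ) 1, C *ᵥ (A ^ k *ᵥ z t) = 0 := by
    intro k
    induction k with
    | zero => intro t ht; simp [z, mulVec_sub, (heq t ht).2]
    | succ k ih =>
      intro t ht
      have h1 : HasDerivWithinAt (fun s => (C * A ^ k) *ᵥ z s) ((C * A ^ k) *ᵥ (A *ᵥ z t))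
          (Set.Icc 0 1) t :=
        (LinearMap.toContinuousLinearMap (C * A ^ k).mulVecLin).hasFDerivAt.comp_hasDerivWithinAt
          t (hz t ht)
      have h2 : HasDerivWithinAt (fun s => (C * A ^ k) *ᵥ z s) 0 (Set.Icc 0 1) t :=
        (hasDerivWithinAt_const t _ (0 : Fin p → ℝ)).congr
          (fun s hs => by rw [← mulVec_mulVec]; exact ih s hs)
          (by rw [← mulVec_mulVec]; exact ih t ht)
      have h3 := (uniqueDiffOn_Icc (zero_lt_one' ℝ) t ht).eq_deriv _ h1 h2
      rw [← h3, pow_succ]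
      simp [mulVec_mulVec, Matrix.mul_assoc]
  have h0 := h (z 0) (mem_unobservableSubspace.2 fun k => hC k 0 (by simp))
  simpa [z, mulVec_sub, sub_eq_zero] using h0

/-! ### Semicontinuity of the unobservable dimension -/

/-- The dimension of the unobservable subspace of a polynomial family of systems is generically
at most its value at a given point. -/
theorem exists_polynomial_finrank_unobservableSubspace_le {σ : Type} {n p : ℕ}
    (A : Matrix (Fin n) (Fin n) (MvPolynomial σ ℝ))
    (C : Matrix (Fin p) (Fin n) (MvPolynomial σ ℝ)) (θ₀ : σ → ℝ) :
    ∃ g : MvPolynomial σ ℝ, MvPolynomial.eval θ₀ g ≠ 0 ∧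
      ∀ θ : σ → ℝ, MvPolynomial.eval θ g ≠ 0 →
        Module.finrank ℝ (unobservableSubspace (A.map (MvPolynomial.eval θ))
            (C.map (MvPolynomial.eval θ))) ≤
          Module.finrank ℝ (unobservableSubspace (A.map (MvPolynomial.eval θ₀))
            (C.map (MvPolynomial.eval θ₀))) := by
  let row : (σ → ℝ) → ℕ × Fin p → Fin n → ℝ := fun θ e =>
    (C.map (MvPolynomial.eval θ) * A.map (MvPolynomial.eval θ) ^ e.1) e.2
  -- A basis of the row space at `θ₀`, chosen among the rows of all `C * A ^ k`.
  obtain ⟨κ, a, -, hspan, hli⟩ := exists_linearIndependent' ℝ (row θ₀)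
  have : Fintype κ := @Fintype.ofFinite κ hli.finite
  classical
  let M : Matrix κ (Fin n) (MvPolynomial σ ℝ) := fun i => (C * A ^ (a i).1) (a i).2
  have hM : ∀ θ : σ → ℝ, M.map (MvPolynomial.eval θ) = Matrix.of (row θ ∘ a) := by
    intro θ
    ext i j
    change MvPolynomial.eval θ ((C * A ^ (a i).1) (a i).2 j) = _
    have := congrFun₂ (Matrix.map_mul (L := C) (M := A ^ (a i).1) (f := MvPolynomial.eval θ))
      (a i).2 j
    rw [Matrix.map_pow] at this
    exact this
  have hdet : ∀ θ : σ → ℝ, MvPolynomial.eval θ (M * Mᵀ).det =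
      (Matrix.of (row θ ∘ a) * (Matrix.of (row θ ∘ a))ᵀ).det := by
    intro θ
    rw [RingHom.map_det, RingHom.mapMatrix_apply, Matrix.map_mul, Matrix.transpose_map, hM]
  have hker : ∀ θ : σ → ℝ, unobservableSubspace (A.map (MvPolynomial.eval θ))
      (C.map (MvPolynomial.eval θ)) ≤ LinearMap.ker (Matrix.of (row θ ∘ a)).mulVecLin := by
    intro θ v hv
    rw [mem_unobservableSubspace] at hv
    rw [LinearMap.mem_ker, mulVecLin_apply]
    ext i
    have := congrFun (hv (a i).1) (a i).2
    rwa [mulVec_mulVec] at this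
  have hker₀ : LinearMap.ker (Matrix.of (row θ₀ ∘ a)).mulVecLin ≤
      unobservableSubspace (A.map (MvPolynomial.eval θ₀)) (C.map (MvPolynomial.eval θ₀)) := by
    intro v hv
    rw [LinearMap.mem_ker, mulVecLin_apply] at hv
    have hle : Submodule.span ℝ (Set.range (row θ₀)) ≤
        LinearMap.ker ((dotProductBilin ℝ ℝ).flip v) := by
      rw [← hspan, Submodule.span_le]
      rintro _ ⟨i, rfl⟩
      exact congrFun hv i
    rw [mem_unobservableSubspace]
    intro k
    rw [mulVec_mulVec]
    ext j
    exact hle (Submodule.subset_span ⟨(k, j), rfl⟩)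
  -- Over the reals the Gram determinant is nonzero exactly when the chosen rows are independent.
  refine ⟨(M * Mᵀ).det, ?_, fun θ hθ => ?_⟩
  · rw [hdet, Ne, ← exists_vecMul_eq_zero_iff]
    rintro ⟨v, hv, h⟩
    have h1 : v ᵥ* Matrix.of (row θ₀ ∘ a) = 0 := by
      rw [← dotProduct_self_eq_zero]
      rw [← vecMul_vecMul, vecMul_transpose] at h
      rw [← dotProduct_mulVec, h, dotProduct_zero]
    exact hv ((Matrix.vecMul_injective_iff.2 hli) (h1.trans (zero_vecMul _).symm))
  · refine (Submodule.finrank_mono (hker θ)).trans (le_trans ?_ (Submodule.finrank_mono hker₀))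
    have h0 : (Matrix.of (row θ₀ ∘ a)).rank = Fintype.card κ := LinearIndependent.rank_matrix hli
    have h1 : (Matrix.of (row θ ∘ a)).rank = Fintype.card κ := by
      rw [hdet] at hθ
      rw [← rank_self_mul_transpose,
        rank_of_isUnit _ ((isUnit_iff_isUnit_det _).2 (isUnit_iff_ne_zero.2 hθ))]
    have e0 := (Matrix.of (row θ₀ ∘ a)).mulVecLin.finrank_range_add_finrank_ker
    have e1 := (Matrix.of (row θ ∘ a)).mulVecLin.finrank_range_add_finrank_ker
    change Matrix.rank _ + _ = _ at e0 e1
    omega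

/-! ### Generic realizations and polynomial criteria -/

/-- The generic realization of a structured matrix, with one indeterminate for each star. -/
noncomputable def Pattern.generic {p n : ℕ} {σ : Type} (M : Pattern p n) (ι : M.Stars → σ) :
    Matrix (Fin p) (Fin n) (MvPolynomial σ ℝ) :=
  fun i j => if h : M i j = true then MvPolynomial.X (ι ⟨(i, j), h⟩) else 0

theorem Pattern.generic_map_eval {p n : ℕ} {σ : Type} (M : Pattern p n) (ι : M.Stars → σ)
    (θ : σ → ℝ) :
    (M.generic ι).map (MvPolynomial.eval θ) = M.realization fun e => θ (ι e) := by
  ext i j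
  by_cases h : M i j = true <;> simp [Pattern.generic, Pattern.realization, h]

theorem Pattern.realization_mulVec_eq_zero {p n : ℕ} (M : Pattern p n) (θ : M.Stars → ℝ)
    {v : Fin n → ℝ} (hv : ∀ i ∈ M.columnStates, v i = 0) : M.realization θ *ᵥ v = 0 := by
  ext k
  refine Finset.sum_eq_zero (fun i _ => ?_ : ∀ i ∈ Finset.univ, M.realization θ k i * v i = 0)
  by_cases h : M k i = true
  · simp [hv i ⟨k, h⟩]
  · simp [Pattern.realization, h]

/-- A vector that is annihilated by all realizations with parameters in the nonvanishing set of
a nonzero polynomial vanishes on all columns that contain a star. -/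
theorem Pattern.eq_zero_of_generic_mulVec_eq_zero {p n : ℕ} (M : Pattern p n)
    {P : (M.Stars → ℝ) → ℝ} (hP : Continuous P) {φ : M.Stars → ℝ} (hφ : P φ ≠ 0)
    {v : Fin n → ℝ} (hv : ∀ ψ, P ψ ≠ 0 → M.realization ψ *ᵥ v = 0)
    {i : Fin n} (hi : i ∈ M.columnStates) : v i = 0 := by
  obtain ⟨k, hk⟩ := hi
  let s : M.Stars := ⟨(k, i), hk⟩
  -- Moving the one parameter at `(k, i)` changes entry `k` of the product by a multiple of `v i`.
  have hcont : Continuous fun ε : ℝ => P (Function.update φ s ε) :=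
    hP.comp (continuous_const.update s continuous_id)
  have hev : ∀ᶠ ε in nhds (φ s), P (Function.update φ s ε) ≠ 0 :=
    hcont.continuousAt.eventually_ne (by simpa using hφ)
  obtain ⟨ε, hε, hne⟩ :=
    ((hev.filter_mono nhdsWithin_le_nhds).and
      (self_mem_nhdsWithin : {φ s}ᶜ ∈ nhdsWithin (φ s) {φ s}ᶜ)).exists
  have h1 := congrFun (hv φ hφ) k
  have h2 := congrFun (hv _ hε) k
  have h3 : ((M.realization (Function.update φ s ε) - M.realization φ) *ᵥ v) k =
      (ε - φ s) * v i := by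
    rw [mulVec, dotProduct, Finset.sum_eq_single i]
    · simp [Pattern.realization, hk, s]
    · intro j _ hj
      by_cases h : M k j = true <;> simp [Pattern.realization, h, s, hj]
    · simp
  rw [sub_mulVec, Pi.sub_apply, h1, h2, sub_self] at h3
  exact (mul_eq_zero.1 h3.symm).resolve_left (sub_ne_zero.2 hne)

/-- A triple is structurally functionally observable if its realizations are functionally
observable wherever some nonzero polynomial in the parameters does not vanish. -/
theorem structurallyFunctionallyObservable_of_polynomial {n p r : ℕ} {A : Pattern n n}
    {C : Pattern p n} {F : Pattern r n} (f : MvPolynomial (A.Stars ⊕ C.Stars ⊕ F.Stars) ℝ)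
    (hf : f ≠ 0) (h : ∀ θ, MvPolynomial.eval θ f ≠ 0 →
      FunctionallyObservable
        (A.realization fun e => θ (Sum.inl e))
        (C.realization fun e => θ (Sum.inr (Sum.inl e)))
        (F.realization fun e => θ (Sum.inr (Sum.inr e)))) :
    StructurallyFunctionallyObservable A C F := by
  refine ⟨{θ | ∀ q ∈ ({f} : Set (MvPolynomial _ ℝ)), MvPolynomial.eval θ q = 0},
    ⟨⟨_, rfl⟩, fun huniv => hf (MvPolynomial.funext fun θ => ?_)⟩, fun θ hθ => h θ ?_⟩
  · have : θ ∈ (Set.univ : Set (A.Stars ⊕ C.Stars ⊕ F.Stars → ℝ)) := trivial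
    rw [← huniv] at this
    simpa using this
  · simpa using hθ

/-- One equation of the variety that fails somewhere suffices: its nonvanishing set avoids the
variety. -/
theorem StructurallyFunctionallyObservable.exists_polynomial {n p r : ℕ} {A : Pattern n n}
    {C : Pattern p n} {F : Pattern r n} (h : StructurallyFunctionallyObservable A C F) :
    ∃ (f : MvPolynomial (A.Stars ⊕ C.Stars ⊕ F.Stars) ℝ) (θ₀ : A.Stars ⊕ C.Stars ⊕ F.Stars → ℝ),
      MvPolynomial.eval θ₀ f ≠ 0 ∧ ∀ θ, MvPolynomial.eval θ f ≠ 0 →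
      FunctionallyObservable
        (A.realization fun e => θ (Sum.inl e))
        (C.realization fun e => θ (Sum.inr (Sum.inl e)))
        (F.realization fun e => θ (Sum.inr (Sum.inr e))) := by
  obtain ⟨V, ⟨⟨S, rfl⟩, hV⟩, hFO⟩ := h
  obtain ⟨θ₀, hθ₀⟩ := (Set.ne_univ_iff_exists_notMem _).1 hV
  simp only [Set.mem_ofPred_eq, not_forall] at hθ₀
  obtain ⟨f, hfS, hf⟩ := hθ₀
  exact ⟨f, θ₀, hf, fun θ hθ => hFO θ fun hmem => hθ (hmem f hfS)⟩

/-! ### Comparison of the two output matrices -/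

/-- The entry of a realization at a star is the value of the parameter of this star. -/
theorem Pattern.realization_apply_of_star {p n : ℕ} (M : Pattern p n) (θ : M.Stars → ℝ)
    (e : M.Stars) {j : Fin p} {i : Fin n} (hj : (e.1.1 : ℕ) = j) (hi : e.1.2 = i) :
    M.realization θ j i = θ e := by
  obtain ⟨⟨j', i'⟩, he⟩ := e
  obtain rfl : j' = j := Fin.ext hj
  obtain rfl : i' = i := hi
  exact dif_pos he

/-- Every star of `C` is, in the same row and column, a star of `C'` if `E_C ⊆ E_{C'}`. -/
theorem Pattern.exists_star_of_sensorEdges_subset {n p p' : ℕ} {C : Pattern p n}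
    {C' : Pattern p' n} (hsub : C.sensorEdges ⊆ C'.sensorEdges) (e : C.Stars) :
    ∃ e' : C'.Stars, (e'.1.1 : ℕ) = e.1.1 ∧ e'.1.2 = e.1.2 := by
  obtain ⟨j, hj, hC⟩ := hsub (show (e.1.2, (e.1.1 : ℕ)) ∈ C.sensorEdges from ⟨e.1.1, rfl, e.2⟩)
  exact ⟨⟨(j, e.1.2), hC⟩, hj.symm, rfl⟩

theorem injective_of_star_position {n p p' : ℕ} {C : Pattern p n} {C' : Pattern p' n}
    {ρ : C.Stars → C'.Stars} (hρ : ∀ e, ((ρ e).1.1 : ℕ) = e.1.1 ∧ (ρ e).1.2 = e.1.2) :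
    Function.Injective ρ := by
  intro e e' h
  refine Subtype.ext (Prod.ext (Fin.ext ?_) ?_)
  · rw [← (hρ e).1, h, (hρ e').1]
  · rw [← (hρ e).2, h, (hρ e').2]

/-- Extending the parameters of `C` by zero to those of `C'` does not lose any output. -/
theorem mulVec_eq_zero_of_extend {n p p' : ℕ} {C : Pattern p n} {C' : Pattern p' n}
    {ρ : C.Stars → C'.Stars} (hρ : ∀ e, ((ρ e).1.1 : ℕ) = e.1.1 ∧ (ρ e).1.2 = e.1.2)
    (c : C.Stars → ℝ) {w : Fin n → ℝ}
    (hw : C'.realization (Function.extend ρ c 0) *ᵥ w = 0) : C.realization c *ᵥ w = 0 := by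
  have hinj := injective_of_star_position hρ
  ext j
  -- A row of `C` without stars need not exist in `C'`, as `p' < p` is possible.
  by_cases hj : ∃ i, C j i = true
  · obtain ⟨i₀, hi₀⟩ := hj
    have hrow : C'.realization (Function.extend ρ c 0) (ρ ⟨(j, i₀), hi₀⟩).1.1 =
        C.realization c j := by
      ext i
      by_cases h : C j i = true
      · rw [C'.realization_apply_of_star _ (ρ ⟨(j, i), h⟩)
          ((hρ _).1.trans (hρ ⟨(j, i₀), hi₀⟩).1.symm) (hρ _).2, hinj.extend_apply]
        simp [Pattern.realization, h]
      · have hne : ∀ h' : C' (ρ ⟨(j, i₀), hi₀⟩).1.1 i = true,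
            ¬ ∃ e, ρ e = ⟨((ρ ⟨(j, i₀), hi₀⟩).1.1, i), h'⟩ := by
          rintro h' ⟨e, he⟩
          have h1 : e.1.1 = j := Fin.ext <| by
            rw [← (hρ e).1, he]
            exact (hρ ⟨(j, i₀), hi₀⟩).1
          have h2 : e.1.2 = i := by
            rw [← (hρ e).2, he]
          exact h (h1 ▸ h2 ▸ e.2)
        rw [show C.realization c j i = 0 from dif_neg h]
        by_cases h' : C' (ρ ⟨(j, i₀), hi₀⟩).1.1 i = true
        · exact (dif_pos h').trans (Function.extend_apply' _ _ _ (hne h'))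
        · exact dif_neg h'
    have := congrFun hw (ρ ⟨(j, i₀), hi₀⟩).1.1
    rw [mulVec, hrow] at this
    exact this
  · refine Finset.sum_eq_zero (fun i _ => ?_ : ∀ i ∈ Finset.univ, C.realization c j i * w i = 0)
    have : ¬ C j i = true := fun h => hj ⟨i, h⟩
    simp [Pattern.realization, this]

/-- If the states of the new sensor edges vanish, then the output under `C'` vanishes as soon as
the output under its restriction to `C` does. -/
theorem mulVec_eq_zero_of_restrict {n p p' : ℕ} {C : Pattern p n} {C' : Pattern p' n}
    {ρ : C.Stars → C'.Stars} (hρ : ∀ e, ((ρ e).1.1 : ℕ) = e.1.1 ∧ (ρ e).1.2 = e.1.2)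
    (c : C'.Stars → ℝ) {w : Fin n → ℝ}
    (hnew : ∀ i ∈ initialVertices (C'.sensorEdges \ C.sensorEdges), w i = 0)
    (hw : C.realization (c ∘ ρ) *ᵥ w = 0) : C'.realization c *ᵥ w = 0 := by
  have hzero : ∀ (j : Fin p') (i : Fin n), (i, (j : ℕ)) ∉ C.sensorEdges →
      C'.realization c j i * w i = 0 := by
    intro j i hC
    by_cases h : C' j i = true
    · rw [hnew i ⟨(i, (j : ℕ)), ⟨⟨j, rfl, h⟩, hC⟩, rfl⟩, mul_zero]
    · simp [Pattern.realization, h]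
  ext j'
  -- Rows beyond those of `C` contain new edges only.
  by_cases hj : (j' : ℕ) < p
  · refine Eq.trans ?_ (congrFun hw ⟨j', hj⟩)
    refine Finset.sum_congr rfl (fun i _ => ?_ : ∀ i ∈ Finset.univ,
      C'.realization c j' i * w i = C.realization (c ∘ ρ) ⟨j', hj⟩ i * w i)
    by_cases h : C ⟨j', hj⟩ i = true
    · rw [C'.realization_apply_of_star c (ρ ⟨(⟨j', hj⟩, i), h⟩) (hρ _).1 (hρ _).2]
      simp [Pattern.realization, h]
    · rw [hzero j' i]
      · simp [Pattern.realization, h]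
      · rintro ⟨j, hjj, hC⟩
        obtain rfl : j = ⟨j', hj⟩ := Fin.ext hjj.symm
        exact h hC
  · refine Finset.sum_eq_zero (fun i _ => hzero j' i ?_ : ∀ i ∈ Finset.univ,
      C'.realization c j' i * w i = 0)
    rintro ⟨j, hjj, -⟩
    exact hj (lt_of_eq_of_lt hjj j.2)

end StructuredSystem

/-! ### Proof of the proposition -/

open StructuredSystem in
theorem mainTheorem8 {n p p' r : ℕ}
    (A : StructuredSystem.Pattern n n) (C : StructuredSystem.Pattern p n)
    (C' : StructuredSystem.Pattern p' n) (F : StructuredSystem.Pattern r n)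
    (hSFO : StructuredSystem.StructurallyFunctionallyObservable A C F)
    (hsub : C.sensorEdges ⊆ C'.sensorEdges)
    (hini : StructuredSystem.initialVertices (C'.sensorEdges \ C.sensorEdges) ⊆
      F.columnStates) :
    StructuredSystem.StructurallyFunctionallyObservable A C' F := by
  choose ρ hρ using fun e => Pattern.exists_star_of_sensorEdges_subset hsub e
  have hinj := injective_of_star_position hρ
  obtain ⟨f, θ₀, hf₀, hf⟩ := hSFO.exists_polynomial
  let φ₀ : F.Stars → ℝ := fun s => θ₀ (Sum.inr (Sum.inr s))
  let pull : (A.Stars ⊕ C'.Stars ⊕ F.Stars → ℝ) → (F.Stars → ℝ) →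
      A.Stars ⊕ C.Stars ⊕ F.Stars → ℝ := fun θ φ =>
    Sum.elim (fun e => θ (Sum.inl e)) (Sum.elim (fun e => θ (Sum.inr (Sum.inl (ρ e)))) φ)
  -- The F-parameters are frozen at `φ₀`, so `f'` constrains only A and C'.
  let f' : MvPolynomial (A.Stars ⊕ C'.Stars ⊕ F.Stars) ℝ := MvPolynomial.bind₁
    (Sum.elim (fun e => MvPolynomial.X (Sum.inl e))
      (Sum.elim (fun e => MvPolynomial.X (Sum.inr (Sum.inl (ρ e))))
        fun s => MvPolynomial.C (φ₀ s))) f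
  have hf' : ∀ θ, MvPolynomial.eval θ f' = MvPolynomial.eval (pull θ φ₀) f := by
    intro θ
    have h := MvPolynomial.aeval_bind₁ (R := ℝ) θ
      (Sum.elim (fun e => MvPolynomial.X (Sum.inl e))
        (Sum.elim (fun e => MvPolynomial.X (Sum.inr (Sum.inl (ρ e))))
          fun s => MvPolynomial.C (φ₀ s))) f
    simp only [MvPolynomial.aeval_eq_eval] at h
    refine h.trans (congrArg (fun q => MvPolynomial.eval q f) (funext ?_))
    rintro (e | e | e) <;> simp [pull]
  have hf'0 : f' ≠ 0 := by
    intro h0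
    have h := hf' (Sum.elim (fun e => θ₀ (Sum.inl e))
      (Sum.elim (Function.extend ρ (fun e => θ₀ (Sum.inr (Sum.inl e))) 0) 0))
    rw [h0, map_zero] at h
    refine hf₀ (Eq.trans (congrArg (fun q => MvPolynomial.eval q f) (funext ?_)) h.symm)
    rintro (e | e | e) <;> simp [pull, φ₀, hinj.extend_apply]
  let dim : (A.Stars → ℝ) × (C.Stars → ℝ) → ℕ := fun x =>
    Module.finrank ℝ (unobservableSubspace (A.realization x.1) (C.realization x.2))
  -- The minimum is over all real parameters, so it also bounds the dimension at the restriction of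
  -- `θ` from below.
  obtain ⟨x₀, hx₀⟩ : ∃ x₀, ∀ x, dim x₀ ≤ dim x :=
    ⟨Function.argmin dim, fun x => Function.argmin_le dim x⟩
  obtain ⟨g, hg₀, hg⟩ := exists_polynomial_finrank_unobservableSubspace_le
    (A.generic (σ := A.Stars ⊕ C'.Stars ⊕ F.Stars) Sum.inl)
    (C'.generic fun e => Sum.inr (Sum.inl e))
    (Sum.elim x₀.1 (Sum.elim (Function.extend ρ x₀.2 0) 0))
  replace hg : ∀ θ, MvPolynomial.eval θ g ≠ 0 →
      Module.finrank ℝ (unobservableSubspace (A.realization fun e => θ (Sum.inl e))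
          (C'.realization fun e => θ (Sum.inr (Sum.inl e)))) ≤
        Module.finrank ℝ (unobservableSubspace (A.realization x₀.1)
          (C'.realization (Function.extend ρ x₀.2 0))) := by
    intro θ hθ
    have h := hg θ hθ
    rwa [Pattern.generic_map_eval, Pattern.generic_map_eval, Pattern.generic_map_eval,
      Pattern.generic_map_eval] at h
  have hg0 : g ≠ 0 := by
    rintro rfl
    simp at hg₀
  refine structurallyFunctionallyObservable_of_polynomial (f' * g) (mul_ne_zero hf'0 hg0)
    fun θ hθ => functionallyObservable_of_mulVec_eq_zero ?_
  rw [map_mul] at hθ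
  have hθf := left_ne_zero_of_mul hθ
  rw [hf'] at hθf
  have hcols : ∀ v ∈ unobservableSubspace (A.realization fun e => θ (Sum.inl e))
      (C.realization ((fun e => θ (Sum.inr (Sum.inl e))) ∘ ρ)),
      ∀ i ∈ F.columnStates, v i = 0 := by
    intro v hv i hi
    have hcont : Continuous fun φ => MvPolynomial.eval (pull θ φ) f := by
      refine (MvPolynomial.continuous_eval f).comp (continuous_pi ?_)
      rintro (e | e | e)
      · exact continuous_const
      · exact continuous_const
      · exact continuous_apply e
    -- A and C stay fixed while F varies; `φ₀` witnesses that the polynomial in F is nonzero.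
    exact F.eq_zero_of_generic_mulVec_eq_zero hcont hθf
      (fun ψ hψ => (hf _ hψ).mulVec_eq_zero hv) hi
  have hle : unobservableSubspace (A.realization fun e => θ (Sum.inl e))
        (C.realization ((fun e => θ (Sum.inr (Sum.inl e))) ∘ ρ)) ≤
      unobservableSubspace (A.realization fun e => θ (Sum.inl e))
        (C'.realization fun e => θ (Sum.inr (Sum.inl e))) := by
    intro v hv
    refine mem_unobservableSubspace.2 fun k => mulVec_eq_zero_of_restrict hρ _ (fun i hi => ?_)
      (mem_unobservableSubspace.1 hv k)
    exact hcols _ (pow_mulVec_mem_unobservableSubspace hv k) i (hini hi)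
  have hext : unobservableSubspace (A.realization x₀.1)
        (C'.realization (Function.extend ρ x₀.2 0)) ≤
      unobservableSubspace (A.realization x₀.1) (C.realization x₀.2) := fun v hv =>
    mem_unobservableSubspace.2 fun k =>
      mulVec_eq_zero_of_extend hρ _ (mem_unobservableSubspace.1 hv k)
  have heq := Submodule.eq_of_le_of_finrank_le hle
    (((hg θ (right_ne_zero_of_mul hθ)).trans (Submodule.finrank_mono hext)).trans (hx₀ (_, _)))
  intro v hv
  rw [← heq] at hv
  exact F.realization_mulVec_eq_zero _ (hcols v hv)
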